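/- Let $k$ and $s$ be positive integers and let $A$ be a finite abelian group (written additively) of odd order and exponent $M$. Notation. For a prime $p$ and an integer $m\ge 1$ let $\mathbb{F}_{p^m}+u\mathbb{F}_{p^m}$ be the ring $\mathbb{F}_{p^m}[u]/\langle u^2\rangle$. For a commutative ring $R$ and a finite abelian group $G$, an abelian code in $R[G]$ is an ideal of the group ring $R[G]$. For a map $\rho:R\to R$ put $\langle \sum_g\alpha_gY^g,\sum_g\beta_gY^g\rangle_\rho=\sum_{g\in G}\alpha_g\rho(\beta_g)$; an abelian code $C$ is self-dual for $\langle\cdot,\cdot\rangle_\rho$ if $C=\{\boldsymbol{x}\in R[G] : \langle \boldsymbol{x},\boldsymbol{y}\rangle_\rho=0\text{ for all }\boldsymbol{y}\in C\}$. It is Euclidean self-dual if this holds with $\rho=\mathrm{id}$, and, for $R=\mathbb{F}_{p^m}+u\mathbb{F}_{p^m}$ with $m$ even, Hermitian self-dual if this holds with $\rho(a+ub)=a^{p^{m/2}}+ub^{p^{m/2}}$. A cyclic code of length $n$ over $R$ is an ideal of $R[\mathbb{Z}_n]$. Let $N(p^m,n)$, $NE(p^m,n)$ and (for $m$ even) $NH(p^m,n)$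 denote the numbers of all, of Euclidean self-dual and of Hermitian self-dual cyclic codes of length $n$ over $\mathbb{F}_{p^m}+u\mathbb{F}_{p^m}$. For odd $d\ge 1$ let $\mathrm{ord}_d(2^k)$ be the multiplicative order of $2^k$ modulo $d$, and let $\chi(d,2^k)=0$ if $d$ divides $2^{kt}+1$ for some integer $t\ge 1$, and $\chi(d,2^k)=1$ otherwise. Let $\mathcal{N}_A(d)$ be the number of elements of order $d$ in $A$. Then the number of Euclidean self-dual abelian codes in $\mathbb{F}_{2^k}[A\times\mathbb{Z}_2\times\mathbb{Z}_{2^s}]$ is $$\bigl(NE(2^k,2^s)\bigr)^{\sum_{d\mid M,\ \mathrm{ord}_d(2^k)=1}(1-\chi(d,2^k))\,\mathcal{N}_A(d)}\ \times\prod_{\substack{d\mid M\\ \mathrm{ord}_d(2^k)\ne 1}}\bigl(NH(2^{k\cdot\mathrm{ord}_d(2^k)},2^s)\bigr)^{(1-\chi(d,2^k))\frac{\mathcal{N}_A(d)}{\mathrm{ord}_d(2^k)}}\ \times\prod_{d\mid M}\bigl(N(2^{k\cdot\mathrm{ord}_d(2^k)},2^s)\bigr)^{\chi(d,2^k)\frac{\mathcal{N}_A(d)}{2\,\mathrm{ord}_d(2^k)}},$$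 where factors with exponent $0$ are read as $1$. This expression makes sense: for every $d\mid M$, $\mathrm{ord}_d(2^k)$ divides $\mathcal{N}_A(d)$; if $\chi(d,2^k)=1$ then $2\,\mathrm{ord}_d(2^k)$ divides $\mathcal{N}_A(d)$; and if $\chi(d,2^k)=0$ and $\mathrm{ord}_d(2^k)\neq 1$ then $k\cdot\mathrm{ord}_d(2^k)$ is even. -/

import Mathlib

namespace AbelianCodes

/-- The ring `F + uF` with `u ^ 2 = 0`, where `F` is the finite field with `p ^ k` elements. -/
abbrev FuF (p k : ℕ) [Fact p.Prime] : Type := DualNumber (GaloisField p k)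

section Duality

variable {R G : Type*} [CommRing R] [AddCommGroup G]

/-- The Euclidean inner product of two elements of the group ring `R[G]`: the sum over `g` of
the products of the coefficients at `g`. -/
noncomputable def euclideanInner (x y : AddMonoidAlgebra R G) : R :=
  x.coeff.sum fun g a => a * y.coeff g

/-- The inner product of two elements of `R[G]` twisted by a map `ρ` in the second argument. -/
noncomputable def twistedInner (ρ : R → R) (x y : AddMonoidAlgebra R G) : R :=
  x.coeff.sum fun g a => a * ρ (y.coeff g)

/-- The Euclidean dual of an ideal of `R[G]`. -/
def euclideanDual (C : Ideal (AddMonoidAlgebra R G)) : Set (AddMonoidAlgebra R G) :=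
  {x | ∀ y ∈ C, euclideanInner x y = 0}

/-- The dual of an ideal of `R[G]` for the inner product twisted by `ρ`. -/
def twistedDual (ρ : R → R) (C : Ideal (AddMonoidAlgebra R G)) : Set (AddMonoidAlgebra R G) :=
  {x | ∀ y ∈ C, twistedInner ρ x y = 0}

/-- An abelian code in `R[G]` is an ideal; it is Euclidean self-dual if it equals its
Euclidean dual. -/
def IsEuclideanSelfDual (C : Ideal (AddMonoidAlgebra R G)) : Prop :=
  (C : Set (AddMonoidAlgebra R G)) = euclideanDual C

/-- A code is self-dual for the inner product twisted by `ρ`. -/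
def IsTwistedSelfDual (ρ : R → R) (C : Ideal (AddMonoidAlgebra R G)) : Prop :=
  (C : Set (AddMonoidAlgebra R G)) = twistedDual ρ C

end Duality

/-- The map `a + u b ↦ a ^ (p ^ (k / 2)) + u b ^ (p ^ (k / 2))` on `F + uF`. For even positive `k`
it is the ring automorphism of order two that defines the Hermitian inner product. -/
noncomputable def hermitianConj (p k : ℕ) [Fact p.Prime] (x : FuF p k) : FuF p k :=
  TrivSqZeroExt.inl (TrivSqZeroExt.fst x ^ p ^ (k / 2)) +
    TrivSqZeroExt.inr (TrivSqZeroExt.snd x ^ p ^ (k / 2))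

/-- `N(p ^ k, n)`: the number of cyclic codes of length `n` over `F + uF`. -/
noncomputable def numCyclic (p k n : ℕ) [Fact p.Prime] : ℕ :=
  Nat.card (Ideal (AddMonoidAlgebra (FuF p k) (ZMod n)))

/-- `NE(p ^ k, n)`: the number of Euclidean self-dual cyclic codes of length `n` over `F + uF`. -/
noncomputable def numEuclideanCyclic (p k n : ℕ) [Fact p.Prime] : ℕ :=
  Nat.card {C : Ideal (AddMonoidAlgebra (FuF p k) (ZMod n)) // IsEuclideanSelfDual C}

/-- `NH(p ^ k, n)`: the number of Hermitian self-dual cyclic codes of length `n` over `F + uF`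
(meaningful for even positive `k`). -/
noncomputable def numHermitianCyclic (p k n : ℕ) [Fact p.Prime] : ℕ :=
  Nat.card {C : Ideal (AddMonoidAlgebra (FuF p k) (ZMod n)) //
    IsTwistedSelfDual (hermitianConj p k) C}

/-- The pair `(j, 2 ^ k)` is good if `j` divides `2 ^ (k t) + 1` for some integer `t ≥ 1`. -/
def IsGood (j k : ℕ) : Prop := ∃ t : ℕ, 1 ≤ t ∧ j ∣ 2 ^ (k * t) + 1

open Classical in
/-- `χ(j, 2 ^ k)`: equal to `0` if the pair is good and to `1` otherwise. -/
noncomputable def chi (j k : ℕ) : ℕ := if IsGood j k then 0 else 1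

/-- The multiplicative order of `2 ^ k` modulo `d`. -/
noncomputable def ordMod (d k : ℕ) : ℕ := orderOf ((2 : ZMod d) ^ k)

/-- The number of elements of order `d` in `A`. -/
noncomputable def numOfOrder (A : Type*) [AddCommGroup A] (d : ℕ) : ℕ :=
  Nat.card {a : A // addOrderOf a = d}

end AbelianCodes

/-!
Write `F = GF(2^k)` and `B = ℤ/2 × ℤ/2^s`. The Euclidean product `⟨x, y⟩` on a group ring is the
constant coefficient of `x * ȳ`, where the bar is induced by the inversion of the group. Since codes
are ideals, a code `C` is self-dual exactly when it is the annihilator of `C̄`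
(`isTwistedSelfDual_iff`), a condition that only involves the ring and its involution.

The order of `A` is odd, so `F[A]` is reduced and is the product of its residue fields `F[A]/m`;
hence `F[A × B]` is the product of the group rings `(F[A]/m)[B]` (`decomposition`). The involution
permutes the maximal ideals `m`. Group algebras over a field have the double annihilator property
(`mem_of_mul_annihilator_eq_zero`), so in a self-dual code the components at two exchanged ideals
determine each other and either of them is arbitrary, while a component at a fixed ideal is
self-dual for the induced involution of `(F[A]/m)[B]` (`card_isSelfDualFor_pi`).

Let `d` be the order of the character of `A` with values in `F[A]/m`. Comparing characters shows
that `F[A]/m` has degree `ord_d(2^k)` over `F`, that `m` is fixed exactly when `-1` is a power of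
`2^k` modulo `d`, and that the involution induced on `F[A]/m` is then trivial if the degree is one,
and the automorphism of order two otherwise (`orderOf_frobenius`, `inversionSpectrum_eq_self_iff`,
`algEquiv_apply_of_inversion`). As inversion is trivial on `ℤ/2`, and `K[ℤ/2] = K + uK` in
characteristic two, each factor is the number of all, of Euclidean self-dual or of Hermitian
self-dual cyclic codes over `K + uK` (`dualNumberGroupRingEquiv`). Finally, `A` has as many
characters of order `d` over an algebraic closure of `F` as elements of order `d`, and each residue
field accounts for as many of them as its degree (`card_residueOrder_mul`).
-/

namespace AbelianCodes

open AddMonoidAlgebra FiniteField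

/-! ### Ideals that annihilate their own conjugate -/

section SelfDual

variable {S T : Type*} [CommRing S] [CommRing T]

/-- The ideal `C` is self-dual for the ring endomorphism `σ`: it is the annihilator of the
image of `C` under `σ`. -/
def IsSelfDualFor (σ : S →+* S) (C : Ideal S) : Prop :=
  ∀ x, x ∈ C ↔ ∀ y ∈ C, x * σ y = 0

lemma IsSelfDualFor.comap {σ : S →+* S} {τ : T →+* T} (e : S ≃+* T)
    (h : ∀ x, e (σ x) = τ (e x)) {C : Ideal T} (hC : IsSelfDualFor τ C) :
    IsSelfDualFor σ (C.comap e) := by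
  intro x
  rw [Ideal.mem_comap, hC (e x)]
  constructor
  · intro H y hy
    apply e.injective
    rw [map_mul, h, H _ hy, map_zero]
  · intro H y hy
    have := H (e.symm y) (show e (e.symm y) ∈ C by simpa using hy)
    have h2 := congrArg e this
    rwa [map_mul, h, map_zero, e.apply_symm_apply] at h2

/-- Ring isomorphisms induce bijections on ideals. -/
def idealEquiv (e : S ≃+* T) : Ideal S ≃ Ideal T where
  toFun C := C.comap e.symm
  invFun C := C.comap e
  left_inv C := by ext x; change e.symm (e x) ∈ C ↔ _; simp
  right_inv C := by ext x; change e (e.symm x) ∈ C ↔ _; simp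

lemma isSelfDualFor_comap_iff {σ : S →+* S} {τ : T →+* T} (e : S ≃+* T)
    (h : ∀ x, e (σ x) = τ (e x)) (C : Ideal T) :
    IsSelfDualFor σ (C.comap e) ↔ IsSelfDualFor τ C := by
  refine ⟨fun hC => ?_, fun hC => hC.comap e h⟩
  have := hC.comap (τ := σ) (σ := τ) e.symm
    (fun x => by rw [RingEquiv.symm_apply_eq, h, e.apply_symm_apply])
  convert this using 1
  ext x
  change _ ↔ e (e.symm x) ∈ C
  simp

/-- An isomorphism intertwining two endomorphisms matches the self-dual ideals. -/
lemma card_isSelfDualFor_congr {σ : S →+* S} {τ : T →+* T} (e : S ≃+* T)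
    (h : ∀ x, e (σ x) = τ (e x)) :
    Nat.card {C : Ideal S // IsSelfDualFor σ C} = Nat.card {C : Ideal T // IsSelfDualFor τ C} :=
  Nat.card_congr ((idealEquiv e).symm.subtypeEquiv
    fun C => (isSelfDualFor_comap_iff e h C).symm).symm

end SelfDual

/-! ### Conjugation of group rings -/

section Conj

variable {R S G : Type*} [CommRing R] [CommRing S] [AddCommGroup G]

variable (G) in
/-- The semilinear conjugation `∑ a_g Y^g ↦ ∑ ρ(a_g) Y^{-g}` of group rings. -/
noncomputable def conj (ρ : R →+* S) : AddMonoidAlgebra R G →+* AddMonoidAlgebra S G :=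
  (mapDomainRingHom S (negAddMonoidHom : G →+ G)).comp (mapRingHom G ρ)

@[simp] lemma conj_single (ρ : R →+* S) (g : G) (r : R) :
    conj G ρ (single g r) = single (-g) (ρ r) := by
  simp [conj]

lemma coeff_conj (ρ : R →+* S) (x : AddMonoidAlgebra R G) (g : G) :
    (conj G ρ x).coeff g = ρ (x.coeff (-g)) := by
  induction x using AddMonoidAlgebra.induction_linear with
  | zero => simp
  | add x y hx hy => simp [hx, hy]
  | single a r =>
    classical
    by_cases h : a = -g <;>
      simp [AddMonoidAlgebra.coeff_single, neg_eq_iff_eq_neg, h]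

/-- The twisted inner product is the constant coefficient of `x` times the conjugate of `y`. -/
lemma coeff_zero_mul_conj (ρ : R →+* R) (x y : AddMonoidAlgebra R G) :
    (x * conj G ρ y).coeff 0 = twistedInner ρ x y := by
  unfold twistedInner
  induction x using AddMonoidAlgebra.induction_linear with
  | zero => simp
  | add x z hx hz =>
    classical
    rw [add_mul, coeff_add, Finsupp.add_apply, hx, hz, coeff_add, Finsupp.sum_add_index'] <;>
      simp [add_mul]
  | single a r =>
    rw [coeff_single, Finsupp.sum_single_index (by simp), coeff_single_mul_apply, coeff_conj]
    simp

/-- Since a code is an ideal, orthogonality to it for the twisted inner product means annihilating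
its conjugate: translating `y` by a group element moves any coefficient of `x * conj y` to `0`. -/
lemma isTwistedSelfDual_iff (ρ : R →+* R) (C : Ideal (AddMonoidAlgebra R G)) :
    IsTwistedSelfDual ρ C ↔ IsSelfDualFor (conj G ρ) C := by
  have key : ∀ x, (∀ y ∈ C, twistedInner ρ x y = 0) ↔ ∀ y ∈ C, x * conj G ρ y = 0 := by
    intro x
    refine ⟨fun H y hy => ?_, fun H y hy => ?_⟩
    · ext g
      have := H (single g 1 * y) (C.mul_mem_left _ hy)
      rw [← coeff_zero_mul_conj, map_mul, conj_single, map_one, mul_left_comm,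
        coeff_single_mul_apply] at this
      simpa using this
    · rw [← coeff_zero_mul_conj, H y hy]; simp
  simp only [IsTwistedSelfDual, Set.ext_iff, SetLike.mem_coe, twistedDual, Set.mem_ofPred_eq,
    IsSelfDualFor, key]

lemma isEuclideanSelfDual_iff (C : Ideal (AddMonoidAlgebra R G)) :
    IsEuclideanSelfDual C ↔ IsSelfDualFor (conj G (RingHom.id R)) C := by
  rw [← isTwistedSelfDual_iff]; rfl

end Conj

/-! ### The double annihilator property -/

section Annihilator

variable {K G : Type*} [Field K] [AddCommGroup G] [Finite G]

/-- Group algebras over a field are Frobenius: every ideal is its own double annihilator. -/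
lemma mem_of_mul_annihilator_eq_zero (I : Ideal (AddMonoidAlgebra K G)) (x : AddMonoidAlgebra K G)
    (hx : ∀ y, (∀ z ∈ I, y * z = 0) → x * y = 0) : x ∈ I := by
  -- The constant coefficient of `x * y` is a nondegenerate symmetric form for which the orthogonal
  -- complement of an ideal is its annihilator.
  let B : LinearMap.BilinForm K (AddMonoidAlgebra K G) :=
    LinearMap.mk₂ K (fun x y => (x * y).coeff 0) (by simp [add_mul]) (by simp)
      (by simp [mul_add]) (by simp)
  have hB : ∀ x y, B x y = (x * y).coeff 0 := fun _ _ => rfl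
  have hsymm : B.IsSymm := ⟨fun x y => by simp [hB, mul_comm]⟩
  have hsep : ∀ x, (∀ y, B x y = 0) → x = 0 := by
    intro x h
    ext g
    have := h (single (-g) 1)
    rw [hB, coeff_mul_single_apply] at this
    simpa using this
  have hnd : B.Nondegenerate :=
    ⟨hsep, fun y h => hsep y fun x => by rw [hB, mul_comm, ← hB, h]⟩
  have horth := LinearMap.BilinForm.orthogonal_orthogonal hnd hsymm.isRefl
    (I.restrictScalars K)
  have : x ∈ I.restrictScalars K := by
    rw [← horth]
    intro y hy
    have hy' : ∀ z ∈ I, y * z = 0 := by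
      intro z hz
      ext g
      have := hy (single (-g) 1 * z) (I.mul_mem_left _ hz)
      rw [hB, mul_assoc, coeff_single_mul_apply] at this
      simpa [mul_comm] using this
    change B y x = 0
    rw [hB, mul_comm, hx y hy']
    simp
  exact this

end Annihilator

/-! ### Families indexed by a set with an involution -/

section Involution

/-- An involution admits a set `P` of representatives for its orbits of size two. -/
lemma exists_orbit_representatives {ι : Type*} [Finite ι] (τ : ι → ι)
    (hτ : Function.Involutive τ) :
    ∃ P : ι → Prop, (∀ i, τ i = i → ¬ P i) ∧ ∀ i, τ i ≠ i → (P (τ i) ↔ ¬ P i) := by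
  obtain ⟨n, ⟨e⟩⟩ := Finite.exists_equiv_fin ι
  refine ⟨fun i => e i < e (τ i), fun i h => by simp [h], fun i h => ?_⟩
  have : e (τ i) ≠ e i := fun H => h (e.injective H)
  simp only [hτ i, not_lt]
  exact ⟨fun H => H.le, fun H => lt_of_le_of_ne H this⟩

/-- Representatives of the orbits of size two make up half of a stable set without fixed points. -/
lemma two_mul_card_representatives {ι : Type*} [Fintype ι] (τ : ι → ι)
    (hτ : Function.Involutive τ) (P : ι → Prop) (T : Finset ι) [DecidablePred P]
    (hT : ∀ i ∈ T, τ i ∈ T) (hP : ∀ i ∈ T, P (τ i) ↔ ¬ P i) :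
    2 * (T.filter P).card = T.card := by
  have : (T.filter P).card = (T.filter fun i => ¬ P i).card := by
    refine Finset.card_bij' (fun i _ => τ i) (fun i _ => τ i) ?_ ?_ (fun i _ => hτ i)
      (fun i _ => hτ i)
    · intro i hi
      rw [Finset.mem_filter] at hi ⊢
      exact ⟨hT i hi.1, by rw [hP i hi.1]; simpa using hi.2⟩
    · intro i hi
      rw [Finset.mem_filter] at hi ⊢
      exact ⟨hT i hi.1, by rw [hP i hi.1]; exact hi.2⟩
  rw [← Finset.card_filter_add_card_filter_not (s := T) P, ← this, two_mul]

/-- A family `x` in which `x i` and `x (τ i)` are related for an involution `τ` of the index set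
is determined by its components at fixed points of `τ`, each related to itself, and by its
unconstrained components at representatives of the orbits of size two. -/
lemma card_related_families {ι : Type*} [Fintype ι] (τ : ι → ι) (hτ : Function.Involutive τ)
    (X : ι → Type*) (r : ∀ i j, τ i = j → X i → X j → Prop)
    (hsymm : ∀ i j (h : τ i = j) (h' : τ j = i) x y, r i j h x y → r j i h' y x)
    (hr : ∀ i j (h : τ i = j) x, ∃! y, r i j h x y)
    (P : ι → Prop) (hP₁ : ∀ i, τ i = i → ¬ P i) (hP₂ : ∀ i, τ i ≠ i → (P (τ i) ↔ ¬ P i))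
    [DecidablePred P] [DecidableEq ι] :
    Nat.card {x : ∀ i, X i // ∀ i j (h : τ i = j), r i j h (x i) (x j)} =
      (∏ i with τ i = i, Nat.card {x : X i // ∀ h : τ i = i, r i i h x x}) *
        ∏ i with P i, Nat.card (X i) := by
  let f : {x : ∀ i, X i // ∀ i j (h : τ i = j), r i j h (x i) (x j)} →
      (∀ i : {i // τ i = i}, {x : X i // ∀ h : τ i.1 = i.1, r i i h x x}) ×
        (∀ i : {i // P i}, X i) :=
    fun x => (fun i => ⟨x.1 i, fun h => x.2 i i h⟩, fun i => x.1 i)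
  have hf : Function.Bijective f := by
    constructor
    · rintro ⟨x, hx⟩ ⟨y, hy⟩ hxy
      simp only [f, Prod.mk.injEq, funext_iff, Subtype.mk.injEq, Subtype.forall] at hxy
      obtain ⟨h₁, h₂⟩ := hxy
      ext i
      by_cases hi : τ i = i
      · exact h₁ i hi
      by_cases hPi : P i
      · exact h₂ i hPi
      have e := h₂ (τ i) ((hP₂ i hi).2 hPi)
      refine (hr (τ i) i (hτ i) (x (τ i))).unique (hx _ _ _) ?_
      rw [e]
      exact hy _ _ _
    · rintro ⟨a, b⟩
      choose p hp _ using hr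
      let x : ∀ i, X i := fun i =>
        if hi : τ i = i then (a ⟨i, hi⟩).1 else
          if hPi : P i then b ⟨i, hPi⟩ else
            p (τ i) i (hτ i) (b ⟨τ i, (hP₂ i hi).2 hPi⟩)
      have hx₁ : ∀ i (hi : τ i = i), x i = (a ⟨i, hi⟩).1 := fun i hi => by simp [x, hi]
      have hx₂ : ∀ i (hi : P i), x i = b ⟨i, hi⟩ := fun i hi => by
        have : τ i ≠ i := fun h => hP₁ i h hi
        simp [x, hi, this]
      have hx₃ : ∀ i j (h : τ i = j), P i → r i j h (x i) (x j) := by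
        rintro i j rfl hi
        have hne : τ i ≠ i := fun h => hP₁ i h hi
        have hne' : τ (τ i) ≠ τ i := fun h => hne (hτ.injective h)
        have hj : ¬ P (τ i) := fun h => (hP₂ i hne).1 h hi
        have e : x (τ i) = p (τ (τ i)) (τ i) (hτ _) (x (τ (τ i))) := by
          rw [hx₂ (τ (τ i)) (by rwa [hτ])]
          simp only [x]
          rw [dif_neg hne', dif_neg hj]
        have := hp (τ (τ i)) (τ i) (hτ _) (x (τ (τ i)))
        rw [← e] at this
        -- Transport along `τ (τ i) = i`, which is not a definitional equality.
        have key : ∀ l, l = i → ∀ h : τ l = τ i, r l (τ i) h (x l) (x (τ i)) →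
          r i (τ i) rfl (x i) (x (τ i)) := by
          rintro l rfl h H; exact H
        exact key _ (hτ i) _ this
      refine ⟨⟨x, ?_⟩, ?_⟩
      · intro i j h
        by_cases hi : τ i = i
        · obtain rfl : i = j := hi.symm.trans h
          rw [hx₁ i hi]
          exact (a ⟨i, hi⟩).2 h
        by_cases hPi : P i
        · exact hx₃ i j h hPi
        · have hPj : P j := h ▸ (hP₂ i hi).2 hPi
          have h' : τ j = i := by rw [← h, hτ]
          exact hsymm j i h' h _ _ (hx₃ j i h' hPj)
      · simp only [f, Prod.mk.injEq]
        refine ⟨funext fun i => Subtype.ext (hx₁ i i.2), funext fun i => hx₂ i i.2⟩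
  rw [Nat.card_eq_of_bijective f hf, Nat.card_prod, Nat.card_pi, Nat.card_pi]
  congr 1
  · rw [← Finset.prod_subtype (Finset.univ.filter fun i => τ i = i) (by simp)
      (fun i => Nat.card {x : X i // ∀ h : τ i = i, r i i h x x})]
  · rw [← Finset.prod_subtype (Finset.univ.filter P) (by simp) (fun i => Nat.card (X i))]

end Involution

/-! ### Self-dual ideals of a product of rings -/

section Product

/-- The self-dual ideals of a finite product of rings with the double annihilator property, for an
endomorphism that permutes the factors by an involution. -/
lemma card_isSelfDualFor_pi {ι : Type*} [Fintype ι] [DecidableEq ι] (τ : ι → ι)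
    (hτ : Function.Involutive τ) (R : ι → Type*) [∀ i, CommRing (R i)]
    (hann : ∀ i (I : Ideal (R i)) (x : R i), (∀ y, (∀ z ∈ I, y * z = 0) → x * y = 0) → x ∈ I)
    (σ : (∀ i, R i) →+* (∀ i, R i)) (θ : ∀ i j, τ i = j → R j →+* R i)
    (hθ : ∀ i j h h' x, θ i j h (θ j i h' x) = x)
    (hσ : ∀ x i j h, σ x i = θ i j h (x j))
    (P : ι → Prop) (hP₁ : ∀ i, τ i = i → ¬ P i) (hP₂ : ∀ i, τ i ≠ i → (P (τ i) ↔ ¬ P i))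
    [DecidablePred P] :
    Nat.card {C : Ideal (∀ i, R i) // IsSelfDualFor σ C} =
      (∏ i with τ i = i,
        Nat.card {C : Ideal (R i) // ∀ h : τ i = i, IsSelfDualFor (θ i i h) C}) *
        ∏ i with P i, Nat.card (Ideal (R i)) := by
  -- `C` and `D` are related when `C` is the annihilator of the conjugate of `D`.
  let r : ∀ i j, τ i = j → Ideal (R i) → Ideal (R j) → Prop := fun i j h C D =>
    ∀ x, x ∈ C ↔ ∀ y ∈ D, x * θ i j h y = 0
  have hsymm : ∀ i j (h : τ i = j) (h' : τ j = i) C D, r i j h C D → r j i h' D C := by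
    intro i j h h' C D H x
    constructor
    · intro hx y hy
      have := congrArg (θ j i h') ((H y).1 hy x hx)
      rwa [map_mul, hθ, map_zero, mul_comm] at this
    · intro hx
      refine hann j D x fun y hy => ?_
      have : θ i j h y ∈ C := (H _).2 fun z hz => by rw [← map_mul, hy z hz, map_zero]
      have := hx _ this
      rwa [hθ] at this
  have hr : ∀ i j (h : τ i = j) C, ∃! D, r i j h C D := by
    intro i j h C
    have h' : τ j = i := by rw [← h, hτ]
    refine ⟨Submodule.annihilator (C.comap (θ i j h)), hsymm j i h' h _ _ ?_, ?_⟩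
    · intro x
      rw [Submodule.mem_annihilator]
      refine ⟨fun H y hy => H _ (by rwa [Ideal.mem_comap, hθ]), fun H y hy => ?_⟩
      have := H _ hy
      rwa [hθ] at this
    · intro D hD
      ext x
      rw [hsymm i j h h' _ _ hD, Submodule.mem_annihilator]
      refine ⟨fun H y hy => ?_, fun H y hy => H _ (by rwa [Ideal.mem_comap, hθ])⟩
      have := H _ hy
      rwa [hθ] at this
  refine Eq.trans ?_ (card_related_families τ hτ (fun i => Ideal (R i)) r hsymm hr P hP₁ hP₂)
  refine (Nat.card_congr
    ((Ideal.piOrderIso (R := R)).symm.toEquiv.subtypeEquiv fun I => ?_)).symm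
  change _ ↔ IsSelfDualFor σ (Ideal.pi I)
  constructor
  · intro H x
    rw [Ideal.mem_pi]
    constructor
    · intro hx y hy
      funext i
      rw [Pi.mul_apply, hσ y i _ rfl]
      exact (H i _ rfl _).1 (hx i) _ (hy _)
    · intro hx i
      refine (H i _ rfl _).2 fun y hy => ?_
      have := congrFun (hx _ (Ideal.single_mem_pi hy)) i
      rwa [Pi.mul_apply, hσ _ i _ rfl, Pi.single_eq_same] at this
  · intro H i j h x
    constructor
    · intro hx y hy
      have := congrFun ((H _).1 (Ideal.single_mem_pi hx) _ (Ideal.single_mem_pi hy)) i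
      rwa [Pi.mul_apply, hσ _ i j h, Pi.single_eq_same, Pi.single_eq_same] at this
    · intro hx
      have : Pi.single i x ∈ Ideal.pi I := by
        refine (H _).2 fun y hy => funext fun l => ?_
        by_cases hl : l = i
        · subst hl
          rw [Pi.mul_apply, hσ _ l j h, Pi.single_eq_same]
          exact hx _ (hy j)
        · simp [hl]
      simpa using this i

end Product

/-! ### Iterated group rings -/

section Curry

/-- The group ring of a product as an iterated group ring, with the second factor outermost. -/
noncomputable def curryRight (R G H : Type*) [CommRing R] [AddCommGroup G] [AddCommGroup H] :
    AddMonoidAlgebra R (G × H) ≃+* AddMonoidAlgebra (AddMonoidAlgebra R G) H :=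
  curryRingEquiv.trans commRingEquiv

@[simp] lemma curryRight_single (R G H : Type*) [CommRing R] [AddCommGroup G] [AddCommGroup H]
    (g : G) (h : H) (r : R) :
    curryRight R G H (single (g, h) r) = single h (single g r) := by
  simp [curryRight]

end Curry

/-! ### The group ring of the group of order two -/

section Dual

variable {K L : Type*} [Field K] [Field L] [CharP L 2]

lemma zmod_two_cases : ∀ b : ZMod 2, b = 0 ∨ b = 1 := by decide

open DualNumber in
/-- The character of `ℤ/2` with values in `L + uL` that sends the generator to `1 + u`. -/
noncomputable def dualNumberChar : Multiplicative (ZMod 2) →* DualNumber L where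
  toFun b := (1 + ε) ^ (Multiplicative.toAdd b).val
  map_one' := by simp
  map_mul' a b := by
    have h2 : (1 + ε : DualNumber L) * (1 + ε) = 1 := by
      have : (2 : L) = 0 := CharTwo.two_eq_zero
      ext
      · simp
      · simp [← two_mul, this]
    have hab : ∀ a b : ZMod 2,
        (1 + ε : DualNumber L) ^ (a + b).val = (1 + ε) ^ a.val * (1 + ε) ^ b.val := by
      intro a b
      rcases zmod_two_cases a with rfl | rfl <;> rcases zmod_two_cases b with rfl | rfl
      · simp
      · simp
      · simp
      · change (1 + ε : DualNumber L) ^ 0 = (1 + ε) ^ 1 * (1 + ε) ^ 1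
        rw [pow_one, h2, pow_zero]
    exact hab _ _

/-- The homomorphism `K[ℤ/2] → L + uL` over `e : K → L` that sends the generator to `1 + u`. -/
noncomputable def dualNumberHom (e : K →+* L) : AddMonoidAlgebra K (ZMod 2) →+* DualNumber L :=
  liftNCRingHom ((TrivSqZeroExt.inlHom L L).comp e) dualNumberChar fun _ _ => Commute.all _ _

open DualNumber in
lemma dualNumberHom_single (e : K →+* L) (b : ZMod 2) (r : K) :
    dualNumberHom e (single b r) = TrivSqZeroExt.inl (e r) * (1 + ε) ^ b.val := by
  simp [dualNumberHom, dualNumberChar, liftNCRingHom]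

lemma fst_dualNumberHom_single (e : K →+* L) (b : ZMod 2) (r : K) :
    TrivSqZeroExt.fst (dualNumberHom e (single b r)) = e r := by
  simp [dualNumberHom_single]

lemma snd_dualNumberHom_single (e : K →+* L) (b : ZMod 2) (r : K) :
    TrivSqZeroExt.snd (dualNumberHom e (single b r)) = e (b.val * r) := by
  rw [dualNumberHom_single]
  rcases zmod_two_cases b with rfl | rfl
  · simp
  · change TrivSqZeroExt.snd (TrivSqZeroExt.inl (e r) * (1 + DualNumber.eps) ^ 1) =
      e ((1 : ℕ) * r)
    simp

lemma eq_single_zero_add_single_one (x : AddMonoidAlgebra K (ZMod 2)) :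
    x = single 0 (x.coeff 0) + single 1 (x.coeff 1) := by
  ext b
  rcases zmod_two_cases b with rfl | rfl <;> simp [coeff_single]

lemma dualNumberHom_bijective (e : K ≃+* L) :
    Function.Bijective (dualNumberHom (e : K →+* L)) := by
  have hv : (1 : ZMod 2).val = 1 := rfl
  constructor
  · rw [injective_iff_map_eq_zero]
    intro x hx
    rw [eq_single_zero_add_single_one x] at hx ⊢
    have h₁ := congrArg TrivSqZeroExt.fst hx
    have h₂ := congrArg TrivSqZeroExt.snd hx
    rw [map_add] at h₁ h₂
    simp only [TrivSqZeroExt.fst_add, TrivSqZeroExt.snd_add, fst_dualNumberHom_single,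
      snd_dualNumberHom_single, hv] at h₁ h₂
    simp at h₁ h₂
    simp [h₂] at h₁
    simp [h₁, h₂]
  · intro x
    refine ⟨single 0 (e.symm (x.fst - x.snd)) + single 1 (e.symm x.snd), ?_⟩
    rw [map_add]
    ext
    · simp [fst_dualNumberHom_single]
    · simp [snd_dualNumberHom_single, hv]

end Dual

/-! ### Codes over a field and cyclic codes over `K + uK` -/

section Count

variable {K : Type*} [Field K] {n : ℕ}

/-- The ring isomorphism `K[ℤ/2 × H] ≃ (L + uL)[H]` over `e : K ≃ L` in characteristic two. -/
noncomputable def dualNumberGroupRingEquiv {L : Type*} [Field L] [CharP L 2] (e : K ≃+* L)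
    (H : Type*) [AddCommGroup H] :
    AddMonoidAlgebra K (ZMod 2 × H) ≃+* AddMonoidAlgebra (DualNumber L) H :=
  (curryRight K (ZMod 2) H).trans
    (mapRingEquiv H (RingEquiv.ofBijective _ (dualNumberHom_bijective e)))

lemma dualNumberGroupRingEquiv_single {L : Type*} [Field L] [CharP L 2] (e : K ≃+* L)
    {H : Type*} [AddCommGroup H] (b : ZMod 2) (h : H) (r : K) :
    dualNumberGroupRingEquiv e H (single (b, h) r) =
      single h (dualNumberHom (e : K →+* L) (single b r)) := by
  simp [dualNumberGroupRingEquiv]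

/-- Inversion is trivial on `ℤ/2`, so a conjugation of `K[ℤ/2 × H]` over `ρ` corresponds to the
conjugation of `(L + uL)[H]` over the extension of `ρ` that fixes `u`. -/
lemma dualNumberGroupRingEquiv_conj {L : Type*} [Field L] [CharP L 2] (e : K ≃+* L)
    {H : Type*} [AddCommGroup H] (ρ : K →+* K) (ρ' : DualNumber L →+* DualNumber L)
    (hfst : ∀ x r, x.fst = e r → (ρ' x).fst = e (ρ r))
    (hsnd : ∀ x r, x.snd = e r → (ρ' x).snd = e (ρ r)) (x : AddMonoidAlgebra K (ZMod 2 × H)) :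
    dualNumberGroupRingEquiv e H (conj _ ρ x) = conj _ ρ' (dualNumberGroupRingEquiv e H x) := by
  induction x using AddMonoidAlgebra.induction_linear with
  | zero => simp
  | add x y hx hy => simp [hx, hy]
  | single a r =>
    obtain ⟨b, h⟩ := a
    have hb : -b = b := ZModModule.neg_eq_self b
    rw [conj_single, Prod.neg_mk, dualNumberGroupRingEquiv_single, dualNumberGroupRingEquiv_single,
      conj_single, hb]
    congr 1
    ext
    · rw [hfst _ r (fst_dualNumberHom_single _ _ _), fst_dualNumberHom_single]; rfl
    · rw [hsnd _ _ (snd_dualNumberHom_single _ _ _), snd_dualNumberHom_single]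
      simp only [map_mul, map_natCast, RingHom.coe_coe]

/-- The conjugation `hermitianConj` as a ring endomorphism. -/
noncomputable def hermitianConjHom (p k : ℕ) [Fact p.Prime] : FuF p k →+* FuF p k where
  toFun := hermitianConj p k
  map_one' := by
    have hp : p ≠ 0 := (Fact.out : p.Prime).ne_zero
    ext <;> simp [hermitianConj, hp]
  map_zero' := by
    have hp : p ≠ 0 := (Fact.out : p.Prime).ne_zero
    ext <;> simp [hermitianConj, hp]
  map_add' x y := by ext <;> simp [hermitianConj, add_pow_char_pow]
  map_mul' x y := by
    ext
    · simp [hermitianConj, mul_pow]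
    · simp [hermitianConj, mul_pow, add_pow_char_pow]

lemma nonempty_ringEquiv_galoisField [Finite K] (hK : Nat.card K = 2 ^ n) (hn : n ≠ 0) :
    Nonempty (K ≃+* GaloisField 2 n) := by
  have := Fintype.ofFinite K
  have := Fintype.ofFinite (GaloisField 2 n)
  refine ⟨FiniteField.ringEquivOfCardEq ?_⟩
  rw [← Nat.card_eq_fintype_card, ← Nat.card_eq_fintype_card, hK, GaloisField.card 2 n hn]

lemma card_ideal_eq_numCyclic [Finite K] (hK : Nat.card K = 2 ^ n) (hn : n ≠ 0) (m : ℕ) :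
    Nat.card (Ideal (AddMonoidAlgebra K (ZMod 2 × ZMod m))) = numCyclic 2 n m := by
  obtain ⟨e⟩ := nonempty_ringEquiv_galoisField hK hn
  exact Nat.card_congr (idealEquiv (T := AddMonoidAlgebra (FuF 2 n) (ZMod m))
    (dualNumberGroupRingEquiv e _))

lemma card_selfDual_eq_numEuclideanCyclic [Finite K] (hK : Nat.card K = 2 ^ n) (hn : n ≠ 0)
    (m : ℕ) :
    Nat.card {C : Ideal (AddMonoidAlgebra K (ZMod 2 × ZMod m)) //
      IsSelfDualFor (conj _ (RingHom.id K)) C} = numEuclideanCyclic 2 n m := by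
  obtain ⟨e⟩ := nonempty_ringEquiv_galoisField hK hn
  simp only [numEuclideanCyclic, isEuclideanSelfDual_iff]
  exact card_isSelfDualFor_congr (T := AddMonoidAlgebra (FuF 2 n) (ZMod m))
    (dualNumberGroupRingEquiv e _)
    (dualNumberGroupRingEquiv_conj e _ _ (by simp) (by simp))

lemma card_selfDual_eq_numHermitianCyclic [Finite K] (hK : Nat.card K = 2 ^ n) (hn : n ≠ 0)
    (m : ℕ) (ρ : K →+* K) (hρ : ∀ x, ρ x = x ^ 2 ^ (n / 2)) :
    Nat.card {C : Ideal (AddMonoidAlgebra K (ZMod 2 × ZMod m)) //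
      IsSelfDualFor (conj _ ρ) C} = numHermitianCyclic 2 n m := by
  obtain ⟨e⟩ := nonempty_ringEquiv_galoisField hK hn
  have h : ∀ C, IsTwistedSelfDual (G := ZMod m) (hermitianConj 2 n) C ↔
      IsSelfDualFor (conj _ (hermitianConjHom 2 n)) C :=
    isTwistedSelfDual_iff (hermitianConjHom 2 n)
  simp only [numHermitianCyclic, h]
  refine card_isSelfDualFor_congr (T := AddMonoidAlgebra (FuF 2 n) (ZMod m))
    (dualNumberGroupRingEquiv e _)
    (dualNumberGroupRingEquiv_conj e _ _ ?_ ?_)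
  · intro x r hx
    simp [hermitianConjHom, hermitianConj, hx, hρ]
  · intro x r hx
    simp [hermitianConjHom, hermitianConj, hx, hρ]

end Count

/-! ### Orders modulo an odd number -/

section Arithmetic

variable {d k : ℕ}

lemma ordMod_dvd_iff {j : ℕ} : ordMod d k ∣ j ↔ 2 ^ (k * j) ≡ 1 [MOD d] := by
  rw [ordMod, orderOf_dvd_iff_pow_eq_one, ← pow_mul, ← ZMod.natCast_eq_natCast_iff]
  push_cast
  rfl

lemma ordMod_pos (hd : Odd d) : 0 < ordMod d k := by
  have hu : IsUnit ((2 : ZMod d) ^ k) := by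
    have : IsUnit (((2 : ℕ) : ZMod d)) :=
      (ZMod.isUnit_iff_coprime 2 d).2 (Nat.coprime_two_left.2 hd)
    exact IsUnit.pow k (by simpa using this)
  have : NeZero d := ⟨by rintro rfl; simp at hd⟩
  obtain ⟨u, hu⟩ := hu
  rw [ordMod, ← hu, orderOf_units]
  exact orderOf_pos u

/-- If `d` divides `2 ^ (k * t) + 1`, then `2 ^ k` has even order modulo the odd number `d`, and
its `t`-th power is the power with half the order, unless the order is one. -/
lemma modEq_half_ordMod (hd : Odd d) {t : ℕ} (ht : d ∣ 2 ^ (k * t) + 1) (h1 : ordMod d k ≠ 1) :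
    Even (ordMod d k) ∧ t ≡ ordMod d k / 2 [MOD ordMod d k] := by
  set n := ordMod d k with hn
  have hneg : ((2 : ZMod d) ^ k) ^ t = -1 := by
    have := (ZMod.natCast_eq_zero_iff _ _).2 ht
    push_cast at this
    rw [← pow_mul]
    exact eq_neg_of_add_eq_zero_left this
  have h2 : n ∣ t * 2 := by
    rw [hn, ordMod, orderOf_dvd_iff_pow_eq_one, pow_mul, hneg]; simp
  -- If `n` divides `t`, then `1 = -1` modulo the odd number `d`, which forces `d = 1` and `n = 1`.
  have hnd : ¬ n ∣ t := by
    intro h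
    rw [hn, ordMod, orderOf_dvd_iff_pow_eq_one, hneg] at h
    have : ((2 : ℕ) : ZMod d) = 0 := by
      push_cast
      rw [← one_add_one_eq_two]
      nth_rewrite 1 [← h]
      simp
    rw [ZMod.natCast_eq_zero_iff] at this
    have hd1 : d = 1 := by
      rcases (Nat.dvd_prime Nat.prime_two).1 this with h | h
      · exact h
      · rw [h] at hd; exact absurd hd (by decide)
    apply h1
    subst hd1
    rw [hn, ordMod, Subsingleton.elim ((2 : ZMod 1) ^ k) 1, orderOf_one]
  -- With `t * 2 = n * c`, the cofactor `c` is odd because `n` does not divide `t`.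
  obtain ⟨c, hc⟩ := h2
  have hce : ¬ Even c := by
    rintro ⟨b, rfl⟩
    exact hnd ⟨b, by linarith⟩
  have hco : Odd c := Nat.not_even_iff_odd.1 hce
  have hne : Even n := by
    have : Even (n * c) := hc ▸ even_two.mul_left t
    exact (Nat.even_mul.1 this).resolve_right hce
  refine ⟨hne, ?_⟩
  obtain ⟨e, he⟩ := hne
  obtain ⟨b, rfl⟩ := hco
  have : t = n * b + e := by nlinarith
  have he2 : n / 2 = e := by omega
  rw [he2, this]
  simp [Nat.ModEq]

end Arithmetic

/-! ### Characters of `A` and the Frobenius automorphism -/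

section Character

variable {F : Type*} [Field F] {A : Type*} [AddCommGroup A]

/-- The character of `A` underlying an algebra homomorphism `F[A] → L`. -/
noncomputable def character {L : Type*} [CommRing L] [Algebra F L]
    (φ : AddMonoidAlgebra F A →ₐ[F] L) : Multiplicative A →* Lˣ :=
  MonoidHom.toHomUnits ((φ : AddMonoidAlgebra F A →* L).comp (of F A))

/-- The order of the character of `A` underlying an algebra homomorphism `F[A] → L`. -/
noncomputable def characterOrder {L : Type*} [CommRing L] [Algebra F L]
    (φ : AddMonoidAlgebra F A →ₐ[F] L) : ℕ :=
  orderOf (character φ)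

lemma characterOrder_dvd_exponent {L : Type*} [CommRing L] [Algebra F L]
    (φ : AddMonoidAlgebra F A →ₐ[F] L) : characterOrder φ ∣ AddMonoid.exponent A := by
  refine orderOf_dvd_of_pow_eq_one (MonoidHom.ext fun a => ?_)
  rw [MonoidHom.pow_apply, ← map_pow]
  have : a ^ AddMonoid.exponent A = 1 :=
    congrArg Multiplicative.ofAdd (AddMonoid.exponent_nsmul_eq_zero a.toAdd)
  rw [this, map_one, MonoidHom.one_apply]

lemma characterOrder_comp {L L' : Type*} [CommRing L] [Algebra F L] [CommRing L'] [Algebra F L']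
    (φ : AddMonoidAlgebra F A →ₐ[F] L) (g : L →ₐ[F] L') (hg : Function.Injective g) :
    characterOrder (g.comp φ) = characterOrder φ := by
  have hu : Function.Injective (Units.map (g : L →* L')) := Units.map_injective hg
  have hcomp : Function.Injective fun χ : Multiplicative A →* Lˣ =>
      (Units.map (g : L →* L')).comp χ := fun χ ψ h => MonoidHom.ext fun a =>
    hu (DFunLike.congr_fun h a)
  exact orderOf_injective (MonoidHom.compHom (Units.map (g : L →* L'))) hcomp (character φ)

variable {L : Type*} [Field L] [Algebra F L]

lemma coe_character (φ : AddMonoidAlgebra F A →ₐ[F] L) (a : Multiplicative A) :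
    (character φ a : L) = φ (single a.toAdd 1) := rfl

/-- The automorphism of `F[A]` induced by the inversion of `A`. -/
noncomputable def inversion (F A : Type*) [Field F] [AddCommGroup A] :
    AddMonoidAlgebra F A ≃ₐ[F] AddMonoidAlgebra F A :=
  domCongr F F (AddEquiv.neg A)

lemma inversion_single (a : A) (r : F) : inversion F A (single a r) = single (-a) r := by
  simp [inversion]

lemma inversion_inversion (x : AddMonoidAlgebra F A) : inversion F A (inversion F A x) = x := by
  induction x using AddMonoidAlgebra.induction_linear with
  | zero => simp
  | add x y hx hy => simp [hx, hy]
  | single a r => simp [inversion_single]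

/-- An algebra homomorphism on `F[A]` is determined by its character. -/
lemma algHom_ext_character {φ ψ : AddMonoidAlgebra F A →ₐ[F] L}
    (h : character φ = character ψ) : φ = ψ := by
  refine AddMonoidAlgebra.algHom_ext (fun a => ?_) (Subsingleton.elim _ _)
  exact congrArg Units.val (DFunLike.congr_fun h (Multiplicative.ofAdd a))

lemma character_comp_inversion (φ : AddMonoidAlgebra F A →ₐ[F] L) :
    character (φ.comp (inversion F A : AddMonoidAlgebra F A →ₐ[F] AddMonoidAlgebra F A)) =
      (character φ)⁻¹ := by
  refine MonoidHom.ext fun a => Units.ext ?_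
  rw [MonoidHom.inv_apply, ← map_inv, coe_character, coe_character]
  simp [inversion_single]

lemma characterOrder_comp_inversion (φ : AddMonoidAlgebra F A →ₐ[F] L) :
    characterOrder (φ.comp (inversion F A : AddMonoidAlgebra F A →ₐ[F] AddMonoidAlgebra F A)) =
      characterOrder φ := by
  rw [characterOrder, character_comp_inversion]
  exact orderOf_inv (character φ)

variable [Fintype F]

lemma character_frobenius_pow_comp [Algebra.IsAlgebraic F L] (φ : AddMonoidAlgebra F A →ₐ[F] L)
    (j : ℕ) :
    character ((frobeniusAlgEquivOfAlgebraic F L ^ j : L ≃ₐ[F] L).toAlgHom.comp φ) =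
      (character φ) ^ (Fintype.card F ^ j) := by
  refine MonoidHom.ext fun a => Units.ext ?_
  rw [MonoidHom.pow_apply, Units.val_pow_eq_pow_val, coe_character, coe_character]
  simp [AlgEquiv.coe_pow, coe_frobeniusAlgEquivOfAlgebraic_iterate]

variable [Finite L] {k : ℕ}

/-- If the image of `F[A]` is all of `L`, then the powers of the Frobenius of `L` over `F` that are
trivial are those that are trivial on the character of `A`. -/
lemma orderOf_frobenius (hF : Fintype.card F = 2 ^ k) (φ : AddMonoidAlgebra F A →ₐ[F] L)
    (hφ : Function.Surjective φ) :
    orderOf (frobeniusAlgEquivOfAlgebraic F L) = ordMod (characterOrder φ) k := by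
  refine Nat.dvd_right_iff_eq.1 fun j => ?_
  rw [characterOrder, orderOf_dvd_iff_pow_eq_one, ordMod_dvd_iff,
    ← pow_eq_pow_iff_modEq (x := character φ), pow_mul, ← hF,
    ← character_frobenius_pow_comp, pow_one]
  refine ⟨fun h => by rw [h]; rfl, fun h => ?_⟩
  have := algHom_ext_character h
  ext x
  obtain ⟨y, rfl⟩ := hφ x
  exact DFunLike.congr_fun this y

/-- The inversion of `A` acts on the character as the `t`-th power of the Frobenius exactly when
`-1` is congruent to `2 ^ (k * t)` modulo the order of the character. -/
lemma frobenius_pow_comp_eq_iff (hF : Fintype.card F = 2 ^ k) (φ : AddMonoidAlgebra F A →ₐ[F] L)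
    (t : ℕ) :
    (frobeniusAlgEquivOfAlgebraic F L ^ t : L ≃ₐ[F] L).toAlgHom.comp φ =
      φ.comp (inversion F A : AddMonoidAlgebra F A →ₐ[F] AddMonoidAlgebra F A) ↔
    characterOrder φ ∣ 2 ^ (k * t) + 1 := by
  rw [characterOrder, orderOf_dvd_iff_pow_eq_one, pow_succ, ← eq_inv_iff_mul_eq_one, pow_mul, ← hF,
    ← character_frobenius_pow_comp, ← character_comp_inversion]
  exact ⟨fun h => by rw [h], algHom_ext_character⟩

/-- The exponent `t = 0` is harmless for goodness: it can be shifted by the order of `2 ^ k`. -/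
lemma isGood_of_dvd {d t : ℕ} (hd : Odd d) (ht : d ∣ 2 ^ (k * t) + 1) : IsGood d k := by
  refine ⟨t + ordMod d k, by have := ordMod_pos (k := k) hd; omega, ?_⟩
  rw [← ZMod.natCast_eq_zero_iff] at ht ⊢
  push_cast at ht ⊢
  have : ((2 : ZMod d) ^ k) ^ ordMod d k = 1 := pow_orderOf_eq_one _
  rwa [mul_add, pow_add, pow_mul 2 k (ordMod d k), this, mul_one]

/-- The inversion of `F[A]` descends along `φ` to an automorphism exactly when `-1` is a power of
`2 ^ k` modulo the order of the character of `φ`. -/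
lemma isGood_iff_exists_algEquiv (hF : Fintype.card F = 2 ^ k) (φ : AddMonoidAlgebra F A →ₐ[F] L)
    (hd : Odd (characterOrder φ)) :
    IsGood (characterOrder φ) k ↔ ∃ θ : L ≃ₐ[F] L, ∀ x, θ (φ x) = φ (inversion F A x) := by
  constructor
  · rintro ⟨t, -, ht⟩
    refine ⟨_, DFunLike.congr_fun ((frobenius_pow_comp_eq_iff hF φ t).2 ht)⟩
  · rintro ⟨θ, hθ⟩
    obtain ⟨t, rfl⟩ := (bijective_frobeniusAlgEquivOfAlgebraic_pow F L).surjective θ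
    refine isGood_of_dvd hd ((frobenius_pow_comp_eq_iff hF φ t).1 ?_)
    exact AlgHom.ext hθ

/-- The automorphism induced by inversion is the power of the Frobenius that defines the Euclidean
or the Hermitian inner product. -/
lemma algEquiv_apply_of_inversion (hF : Fintype.card F = 2 ^ k) (φ : AddMonoidAlgebra F A →ₐ[F] L)
    (hd : Odd (characterOrder φ)) (hφ : Function.Surjective φ) (θ : L ≃ₐ[F] L)
    (hθ : ∀ x, θ (φ x) = φ (inversion F A x)) (x : L) :
    (ordMod (characterOrder φ) k = 1 → θ x = x) ∧
    (ordMod (characterOrder φ) k ≠ 1 →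
      θ x = x ^ 2 ^ (k * ordMod (characterOrder φ) k / 2)) := by
  have hord := orderOf_frobenius hF φ hφ
  obtain ⟨⟨t, _⟩, rfl⟩ := (bijective_frobeniusAlgEquivOfAlgebraic_pow F L).surjective θ
  dsimp only at hθ ⊢
  have ht := (frobenius_pow_comp_eq_iff hF φ t).1 (AlgHom.ext hθ)
  constructor
  · intro h1
    rw [h1, orderOf_eq_one_iff] at hord
    simp [hord]
  · intro h1
    obtain ⟨he, hmod⟩ := modEq_half_ordMod hd ht h1
    rw [← hord] at hmod he ⊢
    rw [pow_eq_pow_iff_modEq.2 hmod, AlgEquiv.coe_pow, coe_frobeniusAlgEquivOfAlgebraic_iterate,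
      hF, ← pow_mul, Nat.mul_div_assoc _ he.two_dvd]

end Character

/-! ### Maximal ideals of `F[A]` -/

section Spectrum

variable {F : Type*} [Field F] {A : Type*} [AddCommGroup A]

/-- The field structure on the residue field of a maximal ideal, which takes maximality from the
bundled point of the maximal spectrum. -/
noncomputable instance (m : MaximalSpectrum (AddMonoidAlgebra F A)) :
    Field (AddMonoidAlgebra F A ⧸ m.asIdeal) :=
  have := m.isMaximal
  Ideal.Quotient.field m.asIdeal

/-- The order of the character of `A` with values in the residue field of a maximal ideal of
`F[A]`. -/
noncomputable def residueOrder (m : MaximalSpectrum (AddMonoidAlgebra F A)) : ℕ :=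
  characterOrder (Ideal.Quotient.mkₐ F m.asIdeal)

lemma residueOrder_dvd_exponent (m : MaximalSpectrum (AddMonoidAlgebra F A)) :
    residueOrder m ∣ AddMonoid.exponent A :=
  characterOrder_dvd_exponent _

/-- The involution on the maximal ideals of `F[A]` induced by the inversion of `A`. -/
noncomputable def inversionSpectrum (m : MaximalSpectrum (AddMonoidAlgebra F A)) :
    MaximalSpectrum (AddMonoidAlgebra F A) :=
  ⟨m.asIdeal.comap (inversion F A : AddMonoidAlgebra F A →ₐ[F] AddMonoidAlgebra F A),
    have := m.isMaximal
    Ideal.comap_isMaximal_of_surjective _ (inversion F A).surjective⟩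

lemma mem_inversionSpectrum (m : MaximalSpectrum (AddMonoidAlgebra F A)) (x) :
    x ∈ (inversionSpectrum m).asIdeal ↔ inversion F A x ∈ m.asIdeal := Iff.rfl

lemma inversionSpectrum_involutive :
    Function.Involutive (inversionSpectrum (F := F) (A := A)) := by
  intro m
  ext x
  rw [mem_inversionSpectrum, mem_inversionSpectrum, inversion_inversion]

/-- The isomorphism of residue fields induced by the inversion of `A`. -/
noncomputable def residueInversion (m n : MaximalSpectrum (AddMonoidAlgebra F A))
    (h : inversionSpectrum m = n) :
    (AddMonoidAlgebra F A ⧸ n.asIdeal) ≃ₐ[F] (AddMonoidAlgebra F A ⧸ m.asIdeal) :=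
  Ideal.quotientEquivAlg _ _ (inversion F A) (by
    subst h
    exact (Ideal.map_comap_of_surjective _ (inversion F A).surjective _).symm)

lemma residueInversion_mk (m n : MaximalSpectrum (AddMonoidAlgebra F A))
    (h : inversionSpectrum m = n) (x : AddMonoidAlgebra F A) :
    residueInversion m n h (Ideal.Quotient.mkₐ F n.asIdeal x) =
      Ideal.Quotient.mkₐ F m.asIdeal (inversion F A x) := rfl

lemma residueInversion_residueInversion (m n : MaximalSpectrum (AddMonoidAlgebra F A))
    (h : inversionSpectrum m = n) (h' : inversionSpectrum n = m)
    (x : AddMonoidAlgebra F A ⧸ m.asIdeal) :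
    residueInversion m n h (residueInversion n m h' x) = x := by
  obtain ⟨x, rfl⟩ := Ideal.Quotient.mkₐ_surjective F _ x
  rw [residueInversion_mk, residueInversion_mk, inversion_inversion]

lemma residueOrder_inversionSpectrum (m : MaximalSpectrum (AddMonoidAlgebra F A)) :
    residueOrder (inversionSpectrum m) = residueOrder m := by
  rw [residueOrder, residueOrder,
    ← characterOrder_comp_inversion (Ideal.Quotient.mkₐ F m.asIdeal),
    ← characterOrder_comp _ (residueInversion m _ rfl).toAlgHom
      (residueInversion m _ rfl).injective]
  rfl

/-- Odd numbers are invertible in `F`, as the cardinality of `F` is a power of two. -/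
lemma neZero_natCast_of_odd [Fintype F] {k : ℕ} (hF : Fintype.card F = 2 ^ k) {n : ℕ} (hn : Odd n) :
    NeZero (n : F) := by
  have h2 : (2 : F) = 0 := by
    have := FiniteField.cast_card_eq_zero F
    rw [hF] at this
    push_cast at this
    exact eq_zero_of_pow_eq_zero this
  obtain ⟨j, rfl⟩ := hn
  exact ⟨by simp [h2]⟩

lemma residueField_algHom_injective {L : Type*} [Field L] [Algebra F L]
    (m : MaximalSpectrum (AddMonoidAlgebra F A)) (g : (AddMonoidAlgebra F A ⧸ m.asIdeal) →ₐ[F] L) :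
    Function.Injective g :=
  RingHom.injective (g : (AddMonoidAlgebra F A ⧸ m.asIdeal) →+* L)

variable [Finite A] [Fintype F] {k : ℕ}

instance : Finite (AddMonoidAlgebra F A) := Module.finite_of_finite F

instance (m : MaximalSpectrum (AddMonoidAlgebra F A)) : Finite (AddMonoidAlgebra F A ⧸ m.asIdeal) :=
  Finite.of_surjective _ Ideal.Quotient.mk_surjective

lemma finrank_residueField (hF : Fintype.card F = 2 ^ k)
    (m : MaximalSpectrum (AddMonoidAlgebra F A)) :
    Module.finrank F (AddMonoidAlgebra F A ⧸ m.asIdeal) = ordMod (residueOrder m) k := by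
  rw [residueOrder, ← orderOf_frobenius hF _ (Ideal.Quotient.mkₐ_surjective F _),
    orderOf_frobeniusAlgEquivOfAlgebraic]

lemma card_residueField (hF : Fintype.card F = 2 ^ k)
    (m : MaximalSpectrum (AddMonoidAlgebra F A)) :
    Nat.card (AddMonoidAlgebra F A ⧸ m.asIdeal) = 2 ^ (k * ordMod (residueOrder m) k) := by
  rw [← finrank_residueField hF, pow_mul, ← hF, ← Nat.card_eq_fintype_card,
    Module.natCard_eq_pow_finrank (K := F)]

/-- A maximal ideal is fixed by the inversion exactly when the order of its character is good. -/
lemma inversionSpectrum_eq_self_iff (hF : Fintype.card F = 2 ^ k)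
    (m : MaximalSpectrum (AddMonoidAlgebra F A)) (hd : Odd (residueOrder m)) :
    inversionSpectrum m = m ↔ IsGood (residueOrder m) k := by
  rw [residueOrder, isGood_iff_exists_algEquiv hF _ hd]
  constructor
  · intro h
    exact ⟨residueInversion m m h, residueInversion_mk m m h⟩
  · rintro ⟨θ, hθ⟩
    ext x
    have h := hθ x
    rw [mem_inversionSpectrum, ← Ideal.Quotient.eq_zero_iff_mem, ← Ideal.Quotient.eq_zero_iff_mem]
    change θ (Ideal.Quotient.mk _ x) = Ideal.Quotient.mk _ _ at h
    rw [← h, EmbeddingLike.map_eq_zero_iff]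

/-- Every character of order `d` with values in an algebraic closure comes from a unique residue
field by an embedding of that field, and each field has as many embeddings as its degree. -/
lemma card_residueOrder_mul (hF : Fintype.card F = 2 ^ k) (hA : Odd (Nat.card A)) (d : ℕ) :
    Nat.card {m : MaximalSpectrum (AddMonoidAlgebra F A) // residueOrder m = d} * ordMod d k =
      numOfOrder A d := by
  classical
  let Ω := AlgebraicClosure F
  let f : (Σ m : {m : MaximalSpectrum (AddMonoidAlgebra F A) // residueOrder m = d},
      (AddMonoidAlgebra F A ⧸ m.1.asIdeal) →ₐ[F] Ω) →
      {χ : Multiplicative A →* Ωˣ // orderOf χ = d} := fun p =>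
    ⟨character (p.2.comp (Ideal.Quotient.mkₐ F p.1.1.asIdeal)), by
      change characterOrder (p.2.comp _) = d
      rw [characterOrder_comp _ _ (residueField_algHom_injective _ p.2)]
      exact p.1.2⟩
  have hf : Function.Bijective f := by
    constructor
    · rintro ⟨⟨m, hm⟩, g⟩ ⟨⟨n, hn⟩, g'⟩ h
      have h := algHom_ext_character (Subtype.ext_iff.1 h)
      dsimp only at g g' h
      obtain rfl : m = n := by
        ext x
        have hx := DFunLike.congr_fun h x
        rw [← Ideal.Quotient.eq_zero_iff_mem, ← Ideal.Quotient.eq_zero_iff_mem]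
        change g (Ideal.Quotient.mk _ x) = g' (Ideal.Quotient.mk _ x) at hx
        rw [← map_eq_zero g, hx, map_eq_zero g']
      congr 1
      refine AlgHom.ext fun x => ?_
      obtain ⟨x, rfl⟩ := Ideal.Quotient.mkₐ_surjective F _ x
      exact DFunLike.congr_fun h x
    · rintro ⟨χ, hχ⟩
      let ψ : AddMonoidAlgebra F A →ₐ[F] Ω := lift F Ω A ((Units.coeHom Ω).comp χ)
      have hψ : character ψ = χ := by
        refine MonoidHom.ext fun a => Units.ext ?_
        rw [coe_character]
        simp [ψ]
      have hprime : (RingHom.ker ψ).IsPrime := RingHom.ker_isPrime _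
      have : IsArtinianRing (AddMonoidAlgebra F A) := inferInstance
      let m : MaximalSpectrum (AddMonoidAlgebra F A) :=
        ⟨RingHom.ker ψ, IsArtinianRing.isMaximal_of_isPrime _⟩
      let g : (AddMonoidAlgebra F A ⧸ m.asIdeal) →ₐ[F] Ω :=
        Ideal.Quotient.liftₐ _ ψ fun a ha => ha
      have hg : g.comp (Ideal.Quotient.mkₐ F m.asIdeal) = ψ := Ideal.Quotient.liftₐ_comp _ _ _
      refine ⟨⟨⟨m, ?_⟩, g⟩, Subtype.ext ?_⟩
      · rw [residueOrder, ← characterOrder_comp _ g (residueField_algHom_injective m g), hg,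
          characterOrder, hψ, hχ]
      · change character (g.comp (Ideal.Quotient.mkₐ F m.asIdeal)) = χ
        rw [hg, hψ]
  have : NeZero ((Monoid.exponent (Multiplicative A) : ℕ) : F) := by
    rw [Monoid.exponent_multiplicative]
    exact neZero_natCast_of_odd hF (hA.of_dvd_nat AddGroup.exponent_dvd_nat_card)
  obtain ⟨e⟩ : Nonempty ((Multiplicative A →* Ωˣ) ≃* Multiplicative A) :=
    CommGroup.monoidHom_mulEquiv_of_hasEnoughRootsOfUnity _ _
  have hcard : Nat.card {χ : Multiplicative A →* Ωˣ // orderOf χ = d} = numOfOrder A d :=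
    Nat.card_congr ((e.toEquiv.trans Multiplicative.toAdd).subtypeEquiv fun χ => by
      rw [← e.orderOf_eq]; rfl)
  have := Fintype.ofFinite {m : MaximalSpectrum (AddMonoidAlgebra F A) // residueOrder m = d}
  rw [← hcard, ← Nat.card_congr (Equiv.ofBijective f hf), Nat.card_sigma]
  rw [Finset.sum_congr rfl fun m _ => ?_, Finset.sum_const, Finset.card_univ, smul_eq_mul,
    Nat.card_eq_fintype_card]
  rw [Nat.card_eq_fintype_card, AlgHom.card, finrank_residueField hF, m.2]

end Spectrum

/-! ### The decomposition of `F[A × B]` -/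

section Decomposition

lemma pi_mapRingHom_bijective {E ι : Type*} [CommRing E] {K : ι → Type*} [∀ i, CommRing (K i)]
    (φ : ∀ i, E →+* K i) (hφ : Function.Bijective fun x i => φ i x) (B : Type*) [AddCommGroup B]
    [Finite B] : Function.Bijective (RingHom.pi fun i => mapRingHom B (φ i)) := by
  constructor
  · intro x y h
    ext b
    refine hφ.injective (funext fun i => ?_)
    have := congrArg (fun z => z.coeff b) (congrFun h i)
    simpa using this
  · intro y
    choose x hx using fun b => hφ.surjective fun i => (y i).coeff b
    refine ⟨ofCoeff (Finsupp.equivFunOnFinite.symm x), funext fun i => ?_⟩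
    ext b
    simpa using congrFun (hx b) i

variable {F : Type*} [Field F] {A : Type*} [AddCommGroup A] [Finite A] [Fintype F] {k : ℕ}

/-- As the order of `A` is odd, `F[A]` is reduced, hence the product of its residue fields. -/
lemma pi_mk_bijective (hF : Fintype.card F = 2 ^ k) (hA : Odd (Nat.card A)) :
    Function.Bijective fun (x : AddMonoidAlgebra F A) =>
      fun m : MaximalSpectrum (AddMonoidAlgebra F A) => Ideal.Quotient.mk m.asIdeal x := by
  have := neZero_natCast_of_odd hF hA
  exact (IsArtinianRing.equivPi (AddMonoidAlgebra F A)).bijective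

/-- The decomposition of `F[A × B]` into group rings of `B` over the residue fields of `F[A]`. -/
noncomputable def decomposition (hF : Fintype.card F = 2 ^ k) (hA : Odd (Nat.card A)) (B : Type*)
    [AddCommGroup B] [Finite B] :
    AddMonoidAlgebra F (A × B) ≃+*
      ∀ m : MaximalSpectrum (AddMonoidAlgebra F A),
        AddMonoidAlgebra (AddMonoidAlgebra F A ⧸ m.asIdeal) B :=
  (curryRight F A B).trans
    (RingEquiv.ofBijective _ (pi_mapRingHom_bijective
      (fun m : MaximalSpectrum (AddMonoidAlgebra F A) => Ideal.Quotient.mk m.asIdeal)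
      (pi_mk_bijective hF hA) B))

lemma decomposition_single (hF : Fintype.card F = 2 ^ k) (hA : Odd (Nat.card A)) {B : Type*}
    [AddCommGroup B] [Finite B] (a : A) (b : B) (r : F)
    (m : MaximalSpectrum (AddMonoidAlgebra F A)) :
    decomposition hF hA B (single (a, b) r) m =
      single b (Ideal.Quotient.mkₐ F m.asIdeal (single a r)) := by
  simp [decomposition]

/-- The involution on the product of the group rings of `B` over the residue fields of `F[A]` that
corresponds to the inversion of `A × B`. -/
noncomputable def piConj (F A B : Type*) [Field F] [AddCommGroup A] [AddCommGroup B] :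
    (∀ m : MaximalSpectrum (AddMonoidAlgebra F A),
      AddMonoidAlgebra (AddMonoidAlgebra F A ⧸ m.asIdeal) B) →+*
    ∀ m : MaximalSpectrum (AddMonoidAlgebra F A),
      AddMonoidAlgebra (AddMonoidAlgebra F A ⧸ m.asIdeal) B :=
  RingHom.pi fun m =>
    (conj B (residueInversion m (inversionSpectrum m) rfl).toRingEquiv.toRingHom).comp
      (Pi.evalRingHom _ (inversionSpectrum m))

lemma decomposition_conj (hF : Fintype.card F = 2 ^ k) (hA : Odd (Nat.card A)) {B : Type*}
    [AddCommGroup B] [Finite B] (x : AddMonoidAlgebra F (A × B)) :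
    decomposition hF hA B (conj _ (RingHom.id F) x) = piConj F A B (decomposition hF hA B x) := by
  induction x using AddMonoidAlgebra.induction_linear with
  | zero => simp
  | add x y hx hy => simp [hx, hy]
  | single p r =>
    obtain ⟨a, b⟩ := p
    funext m
    rw [conj_single, Prod.neg_mk, decomposition_single, piConj, RingHom.pi_apply,
      RingHom.comp_apply, Pi.evalRingHom_apply, decomposition_single, conj_single]
    congr 1
    change _ = residueInversion m _ rfl _
    rw [residueInversion_mk, inversion_single]
    rfl

/-- A Euclidean self-dual code of `F[A × B]` amounts to a self-dual ideal for each maximal ideal of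
`F[A]` fixed by the inversion and an arbitrary ideal for each pair of exchanged maximal ideals. -/
lemma card_isEuclideanSelfDual (hF : Fintype.card F = 2 ^ k) (hA : Odd (Nat.card A)) {B : Type*}
    [AddCommGroup B] [Finite B] [Fintype (MaximalSpectrum (AddMonoidAlgebra F A))]
    [DecidableEq (MaximalSpectrum (AddMonoidAlgebra F A))]
    (P : MaximalSpectrum (AddMonoidAlgebra F A) → Prop)
    (hP₁ : ∀ m, inversionSpectrum m = m → ¬ P m)
    (hP₂ : ∀ m, inversionSpectrum m ≠ m → (P (inversionSpectrum m) ↔ ¬ P m)) [DecidablePred P] :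
    Nat.card {C : Ideal (AddMonoidAlgebra F (A × B)) // IsEuclideanSelfDual C} =
      (∏ m : MaximalSpectrum (AddMonoidAlgebra F A) with inversionSpectrum m = m,
        Nat.card {C : Ideal (AddMonoidAlgebra (AddMonoidAlgebra F A ⧸ m.asIdeal) B) //
          ∀ h : inversionSpectrum m = m,
            IsSelfDualFor (conj B (residueInversion m m h).toRingEquiv.toRingHom) C}) *
        ∏ m : MaximalSpectrum (AddMonoidAlgebra F A) with P m,
          Nat.card (Ideal (AddMonoidAlgebra (AddMonoidAlgebra F A ⧸ m.asIdeal) B)) := by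
  simp only [isEuclideanSelfDual_iff]
  rw [card_isSelfDualFor_congr (decomposition hF hA B) (decomposition_conj hF hA)]
  refine card_isSelfDualFor_pi inversionSpectrum inversionSpectrum_involutive _
    (fun m I x => mem_of_mul_annihilator_eq_zero I x) (piConj F A B)
    (fun m n h => conj B (residueInversion m n h).toRingEquiv.toRingHom) ?_ ?_ P hP₁ hP₂
  · intro m n h h' x
    ext b
    rw [coeff_conj, coeff_conj, neg_neg]
    exact residueInversion_residueInversion m n h h' _
  · rintro x m _ rfl
    rfl

end Decomposition

/-! ### Counting maximal ideals by the order of their character -/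

section Counting

variable {F : Type*} [Field F] {A : Type*} [AddCommGroup A]

lemma odd_residueOrder (hA : Odd (Nat.card A)) (m : MaximalSpectrum (AddMonoidAlgebra F A)) :
    Odd (residueOrder m) :=
  hA.of_dvd_nat ((residueOrder_dvd_exponent m).trans AddGroup.exponent_dvd_nat_card)

variable [Finite A] [Fintype F] {k : ℕ}

lemma card_ideal_residue (hF : Fintype.card F = 2 ^ k) (hk : k ≠ 0) (hA : Odd (Nat.card A)) (n : ℕ)
    (m : MaximalSpectrum (AddMonoidAlgebra F A)) :
    Nat.card (Ideal (AddMonoidAlgebra (AddMonoidAlgebra F A ⧸ m.asIdeal) (ZMod 2 × ZMod n))) =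
      numCyclic 2 (k * ordMod (residueOrder m) k) n :=
  card_ideal_eq_numCyclic (card_residueField hF m)
    (mul_ne_zero hk (ordMod_pos (odd_residueOrder hA m)).ne') n

/-- The self-dual components at a fixed maximal ideal correspond to Euclidean self-dual cyclic codes
if the residue field is `F`, and to Hermitian self-dual ones otherwise. -/
lemma card_selfDual_residue (hF : Fintype.card F = 2 ^ k) (hk : k ≠ 0) (hA : Odd (Nat.card A))
    (n : ℕ) (m : MaximalSpectrum (AddMonoidAlgebra F A)) (hm : inversionSpectrum m = m) :
    Nat.card {C : Ideal (AddMonoidAlgebra (AddMonoidAlgebra F A ⧸ m.asIdeal) (ZMod 2 × ZMod n)) //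
      ∀ h : inversionSpectrum m = m,
        IsSelfDualFor (conj _ (residueInversion m m h).toRingEquiv.toRingHom) C} =
      if ordMod (residueOrder m) k = 1 then numEuclideanCyclic 2 k n
      else numHermitianCyclic 2 (k * ordMod (residueOrder m) k) n := by
  have hcard := card_residueField hF m
  have hn := mul_ne_zero hk (ordMod_pos (k := k) (odd_residueOrder hA m)).ne'
  have hθ := algEquiv_apply_of_inversion hF (Ideal.Quotient.mkₐ F m.asIdeal) (odd_residueOrder hA m)
    (Ideal.Quotient.mkₐ_surjective F _) (residueInversion m m hm) (residueInversion_mk m m hm)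
  simp only [hm, forall_true_left]
  split_ifs with h1
  · have hid : (residueInversion m m hm).toRingEquiv.toRingHom = RingHom.id _ :=
      RingHom.ext fun x => (hθ x).1 h1
    rw [hid]
    rw [h1, mul_one] at hcard
    exact card_selfDual_eq_numEuclideanCyclic hcard hk n
  · exact card_selfDual_eq_numHermitianCyclic hcard hn n _ fun x => (hθ x).2 h1

variable [Fintype (MaximalSpectrum (AddMonoidAlgebra F A))]

lemma card_filter_residueOrder_mul (hF : Fintype.card F = 2 ^ k) (hA : Odd (Nat.card A)) (d : ℕ) :
    (Finset.univ.filter fun m : MaximalSpectrum (AddMonoidAlgebra F A) =>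
      residueOrder m = d).card * ordMod d k = numOfOrder A d := by
  rw [← card_residueOrder_mul hF hA d, Nat.card_eq_fintype_card, Fintype.card_subtype]

/-- The maximal ideals belonging to `d` are all fixed by the inversion if `d` is good, and none is
otherwise. -/
lemma card_filter_fixed [DecidableEq (MaximalSpectrum (AddMonoidAlgebra F A))]
    (hF : Fintype.card F = 2 ^ k) (hA : Odd (Nat.card A)) {d : ℕ}
    (hd : Odd d) :
    (Finset.univ.filter fun m : MaximalSpectrum (AddMonoidAlgebra F A) =>
      inversionSpectrum m = m ∧ residueOrder m = d).card =
      (1 - chi d k) * (numOfOrder A d / ordMod d k) := by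
  rw [← card_filter_residueOrder_mul hF hA d, Nat.mul_div_cancel _ (ordMod_pos hd)]
  by_cases hg : IsGood d k
  · simp only [chi, hg, if_true, tsub_zero, one_mul]
    congr 1
    refine Finset.filter_congr fun m _ => and_iff_right_of_imp ?_
    rintro rfl
    exact (inversionSpectrum_eq_self_iff hF m hd).2 hg
  · simp only [chi, hg, if_false, tsub_self, zero_mul, Finset.card_eq_zero,
      Finset.filter_eq_empty_iff]
    rintro m - ⟨h, rfl⟩
    exact hg ((inversionSpectrum_eq_self_iff hF m hd).1 h)

lemma two_mul_card_filter_representatives (hF : Fintype.card F = 2 ^ k) (hA : Odd (Nat.card A))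
    {d : ℕ} (hd : Odd d) (P : MaximalSpectrum (AddMonoidAlgebra F A) → Prop) [DecidablePred P]
    (hP₂ : ∀ m, inversionSpectrum m ≠ m → (P (inversionSpectrum m) ↔ ¬ P m)) (hg : ¬ IsGood d k) :
    (Finset.univ.filter fun m => P m ∧ residueOrder m = d).card * (2 * ordMod d k) =
      numOfOrder A d := by
  rw [← card_filter_residueOrder_mul hF hA d, ← two_mul_card_representatives inversionSpectrum
    inversionSpectrum_involutive P (Finset.univ.filter fun m => residueOrder m = d),
    Finset.filter_filter]
  · simp only [and_comm]
    ring
  · intro m hm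
    simpa [residueOrder_inversionSpectrum] using hm
  · intro m hm
    refine hP₂ m fun h => hg ?_
    obtain rfl : residueOrder m = d := by simpa using hm
    exact (inversionSpectrum_eq_self_iff hF m hd).1 h

lemma card_filter_representatives (hF : Fintype.card F = 2 ^ k) (hA : Odd (Nat.card A))
    {d : ℕ} (hd : Odd d) (P : MaximalSpectrum (AddMonoidAlgebra F A) → Prop) [DecidablePred P]
    (hP₁ : ∀ m, inversionSpectrum m = m → ¬ P m)
    (hP₂ : ∀ m, inversionSpectrum m ≠ m → (P (inversionSpectrum m) ↔ ¬ P m)) :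
    (Finset.univ.filter fun m => P m ∧ residueOrder m = d).card =
      chi d k * (numOfOrder A d / (2 * ordMod d k)) := by
  by_cases hg : IsGood d k
  · simp only [chi, hg, if_true, zero_mul, Finset.card_eq_zero, Finset.filter_eq_empty_iff]
    rintro m - ⟨h, rfl⟩
    exact hP₁ m ((inversionSpectrum_eq_self_iff hF m hd).2 hg) h
  · have := ordMod_pos (k := k) hd
    rw [← two_mul_card_filter_representatives hF hA hd P hP₂ hg,
      Nat.mul_div_cancel _ (by positivity)]
    simp [chi, hg]

end Counting
end AbelianCodes

open AbelianCodes in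
theorem theorem2p3 (k s : ℕ) (hk : 0 < k) (hs : 0 < s)
    (A : Type*) [AddCommGroup A] [Finite A] (hA : Odd (Nat.card A))
    (M : ℕ) (hM : M = AddMonoid.exponent A) :
    (∀ d ∈ M.divisors,
      AbelianCodes.ordMod d k ∣ AbelianCodes.numOfOrder A d ∧
      (AbelianCodes.chi d k = 1 →
        2 * AbelianCodes.ordMod d k ∣ AbelianCodes.numOfOrder A d) ∧
      (AbelianCodes.chi d k = 0 → AbelianCodes.ordMod d k ≠ 1 →
        Even (k * AbelianCodes.ordMod d k))) ∧
    Nat.card {C : Ideal (AddMonoidAlgebra (GaloisField 2 k) (A × ZMod 2 × ZMod (2 ^ s))) //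
        AbelianCodes.IsEuclideanSelfDual C} =
      AbelianCodes.numEuclideanCyclic 2 k (2 ^ s) ^
          (∑ d ∈ M.divisors with AbelianCodes.ordMod d k = 1,
            (1 - AbelianCodes.chi d k) * AbelianCodes.numOfOrder A d) *
        (∏ d ∈ M.divisors with AbelianCodes.ordMod d k ≠ 1,
          AbelianCodes.numHermitianCyclic 2 (k * AbelianCodes.ordMod d k) (2 ^ s) ^
            ((1 - AbelianCodes.chi d k) *
              (AbelianCodes.numOfOrder A d / AbelianCodes.ordMod d k))) *
        (∏ d ∈ M.divisors,
          AbelianCodes.numCyclic 2 (k * AbelianCodes.ordMod d k) (2 ^ s) ^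
            (AbelianCodes.chi d k *
              (AbelianCodes.numOfOrder A d / (2 * AbelianCodes.ordMod d k)))) := by
  classical
  have := Fintype.ofFinite (GaloisField 2 k)
  have hF : Fintype.card (GaloisField 2 k) = 2 ^ k := by
    rw [← Nat.card_eq_fintype_card, GaloisField.card 2 k hk.ne']
  have := Fintype.ofFinite (MaximalSpectrum (AddMonoidAlgebra (GaloisField 2 k) A))
  have hodd : ∀ d ∈ M.divisors, Odd d := fun d hd => hA.of_dvd_nat
    ((Nat.dvd_of_mem_divisors hd).trans (hM ▸ AddGroup.exponent_dvd_nat_card))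
  obtain ⟨P, hP₁, hP₂⟩ := exists_orbit_representatives
    (inversionSpectrum (F := GaloisField 2 k) (A := A)) inversionSpectrum_involutive
  have hmem : ∀ m : MaximalSpectrum (AddMonoidAlgebra (GaloisField 2 k) A),
      residueOrder m ∈ M.divisors := fun m => by
    rw [Nat.mem_divisors, hM]
    exact ⟨residueOrder_dvd_exponent m, AddMonoid.exponent_ne_zero_of_finite⟩
  refine ⟨fun d hd => ⟨⟨_, ((mul_comm _ _).trans (card_residueOrder_mul hF hA d)).symm⟩,
    fun hχ => ?_, fun hχ h1 => ?_⟩, ?_⟩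
  · have hg : ¬ IsGood d k := fun h => by simp [chi, h] at hχ
    exact ⟨_, ((mul_comm _ _).trans (two_mul_card_filter_representatives hF hA (hodd d hd) P hP₂
      hg)).symm⟩
  · obtain ⟨t, -, ht⟩ : IsGood d k := by
      by_contra h
      simp [chi, h] at hχ
    exact (modEq_half_ordMod (hodd d hd) ht h1).1.mul_left k
  have : NeZero (2 ^ s) := ⟨by positivity⟩
  rw [card_isEuclideanSelfDual hF hA P hP₁ hP₂]
  congr 1
  · rw [Finset.prod_congr rfl fun m hm =>
      card_selfDual_residue hF hk.ne' hA (2 ^ s) m (Finset.mem_filter.1 hm).2,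
      ← Finset.prod_fiberwise_of_maps_to (fun m _ => hmem m)]
    rw [← Finset.prod_pow_eq_pow_sum, Finset.prod_filter, Finset.prod_filter,
      ← Finset.prod_mul_distrib]
    refine Finset.prod_congr rfl fun d hd => ?_
    rw [Finset.prod_congr rfl fun m hm => by rw [(Finset.mem_filter.1 hm).2], Finset.prod_const,
      Finset.filter_filter, card_filter_fixed hF hA (hodd d hd)]
    by_cases h1 : ordMod d k = 1 <;> simp [h1]
  · rw [Finset.prod_congr rfl fun m _ => card_ideal_residue hF hk.ne' hA (2 ^ s) m,
      ← Finset.prod_fiberwise_of_maps_to (fun m _ => hmem m)]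
    refine Finset.prod_congr rfl fun d hd => ?_
    rw [Finset.prod_congr rfl fun m hm => by rw [(Finset.mem_filter.1 hm).2], Finset.prod_const,
      Finset.filter_filter, card_filter_representatives hF hA (hodd d hd) P hP₁ hP₂]
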